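/- Let $\Lambda\subset\mathbb{C}$ be a lattice of rank two (equivalently, the period lattice of a non-degenerate elliptic curve), let $\sigma$ and $\zeta$ be its Weierstrass functions, let $s\in\mathbb{C}\setminus\Lambda$ and $\alpha\in\mathbb{C}$, and put $$\Phi_s(t)=\frac{\sigma(s-t)}{\sigma(s)\sigma(t)}\,e^{\zeta(s)t},\qquad f(t)=\frac{e^{\alpha t}}{\Phi_s(t)} .$$ Let $n\ge 1$ be an integer and suppose that $f$ is a solution of the Hirzebruch $n$-equation $$\sum_{k=0}^n\ \prod_{i\ne k}\frac{1}{f(u_i-u_k)}=C$$ for some constant $C\in\mathbb{C}$ (for all pairwise distinct $u_0,\dots,u_n$ close to $0$). Then: 1. $C=0$; 2. for every period $\omega\in\Lambda$ there is a constant $\varepsilon\in\mathbb{C}$ with $\frac{1}{f(t+\omega)}=\frac{\varepsilon}{f(t)}$ for all $t\notin\Lambda$, and $\varepsilon^{n+1}=1$; 3. $f$ is an elliptic function of level $d$ (for the lattice $\Lambda$) for some $d$ dividing $n+1$. Here $f$ is called an elliptic function of level $d$ for $\Lambda$, where $d>1$ is an integer, if $f(t)=t+\cdots$ is a meromorphic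 $d$-th root of a $\Lambda$-periodic meromorphic function $g(t)=t^d+\cdots$ which has a zero of order $d$ at $0$, a pole of order $d$ at some point $P\notin\Lambda$, and no other zeros and poles modulo $\Lambda$. -/

import Mathlib

open Filter Topology

namespace Krichever

noncomputable section

/-- The Weierstrass function `σ(z) = z ∏_{ω ∈ Λ, ω ≠ 0} (1 - z/ω) exp(z/ω + z²/(2ω²))`.
The product is written over all of `Λ`: since division by zero gives zero, the factor with
`ω = 0` is equal to `1`. -/
def sigma (L : PeriodPair) (z : ℂ) : ℂ :=
  z * ∏' w : L.lattice,
    (1 - z / (w : ℂ)) * Complex.exp (z / (w : ℂ) + z ^ 2 / (2 * (w : ℂ) ^ 2))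

/-- The Weierstrass function
`ζ(z) = 1/z + ∑_{ω ∈ Λ, ω ≠ 0} (1/(z - ω) + 1/ω + z/ω²)`.
The sum is written over all of `Λ`: since division by zero gives zero, the term with `ω = 0`
is equal to `1/z`. -/
def zeta (L : PeriodPair) (z : ℂ) : ℂ :=
  ∑' w : L.lattice, (1 / (z - (w : ℂ)) + 1 / (w : ℂ) + z / (w : ℂ) ^ 2)

/-- The Baker--Akhiezer function `Φ_s(t) = σ(s - t) / (σ(s) σ(t)) · exp(ζ(s) t)`. -/
def bakerAkhiezer (L : PeriodPair) (s t : ℂ) : ℂ :=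
  sigma L (s - t) / (sigma L s * sigma L t) * Complex.exp (zeta L s * t)

/-- The function `f(t) = exp(α t) / Φ_s(t)` defining a Krichever genus. -/
def kricheverFun (L : PeriodPair) (s α t : ℂ) : ℂ :=
  Complex.exp (α * t) / bakerAkhiezer L s t

/-- The Hirzebruch `n`-equation `∑_{k=0}^n ∏_{i ≠ k} 1 / f(u_i - u_k) = C` for (the germ at `0`
of) a function `f` with `f(0) = 0`, `f'(0) = 1`: it is required for all pairwise distinct
`u_0, …, u_n` close to `0`, where no denominator vanishes. -/
def HirzebruchEquation (n : ℕ) (f : ℂ → ℂ) (C : ℂ) : Prop :=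
  ∀ᶠ u : Fin (n + 1) → ℂ in 𝓝 0, Function.Injective u →
    ∑ k, ∏ i ∈ Finset.univ.erase k, 1 / f (u i - u k) = C

/-- `ε` is the multiplier of `f` under the shift by the period `ω` of `Λ`:
`1 / f(t + ω) = ε / f(t)` away from the lattice (where `1 / f` has its poles). -/
def IsMultiplier (L : PeriodPair) (f : ℂ → ℂ) (w ε : ℂ) : Prop :=
  ∀ t : ℂ, t ∉ L.lattice → 1 / f (t + w) = ε / f t

/-- `g` is a `Λ`-periodic meromorphic function with a zero of order `d` at `0`, a pole of order
`d` at `P`, no other zeros and poles modulo `Λ`, and the normalization `g(t) = t^d + ⋯`. -/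
structure IsLevelPower (L : PeriodPair) (d : ℕ) (P : ℂ) (g : ℂ → ℂ) : Prop where
  meromorphic : Meromorphic g
  periodic : ∀ w ∈ L.lattice, ∀ t : ℂ, g (t + w) = g t
  pole_notMem : P ∉ L.lattice
  order_zero : meromorphicOrderAt g 0 = ((d : ℤ) : WithTop ℤ)
  order_pole : meromorphicOrderAt g P = ((-(d : ℤ) : ℤ) : WithTop ℤ)
  order_other : ∀ t : ℂ, t ∉ L.lattice → t - P ∉ L.lattice → meromorphicOrderAt g t = 0
  normalized : Tendsto (fun t ↦ g t / t ^ d) (𝓝[≠] 0) (𝓝 1)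

/-- `f` is an elliptic function of level `d` for the lattice `Λ`: `d > 1` and `f` is the `d`-th
root `f(t) = t + ⋯` of a function `g` as above. Equality of the meromorphic functions `f ^ d`
and `g` is equality off a closed discrete set. -/
def IsEllipticOfLevel (L : PeriodPair) (d : ℕ) (f : ℂ → ℂ) : Prop :=
  1 < d ∧ Meromorphic f ∧ Tendsto (fun t ↦ f t / t) (𝓝[≠] 0) (𝓝 1) ∧
    ∃ (P : ℂ) (g : ℂ → ℂ), IsLevelPower L d P g ∧ (fun t ↦ f t ^ d) =ᶠ[codiscrete ℂ] g

end

end Krichever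

/-!
Write `F = 1 / f`. By the quasi-periodicity of the Weierstrass `σ`-function, a shift by a period
`w` multiplies `f` by a constant `δ(w) ≠ 0`, and `f` has, modulo `Λ`, a single zero (simple, at
`0`) and a single pole (simple, at `s`).

*Quasi-periodicity of `σ`.* The product for `σ` converges locally uniformly, so its logarithmic
derivative can be computed termwise and is `ζ`; likewise `ζ' = -℘`. As `℘` is periodic,
`ζ(z + w) - ζ(z)` is a constant `η`, and integrating once more `σ(z + w) = c exp(η z) σ(z)`
(`exists_sigma_add`). The value `ζ(s)` in the exponent of `Φ_s` plays no role: any constant would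
do.

*Multipliers are roots of unity.* The Hirzebruch equation is continued analytically in the single
variable `u₀ = x`, the others being fixed near `0`
(`exists_hirzebruchEquation_continued`). Let `T` be its term with `k = 0`. Replacing `x` by `x + w`
multiplies `T` by `δⁿ` and the remaining terms by `δ⁻¹`, so that
`(δⁿ - δ⁻¹) T(x) = C (1 - δ⁻¹)`. Since `1 / T(x) = ∏ᵢ f(uᵢ - x)` tends to `0` as `x → u₁`, both
sides vanish: `δⁿ⁺¹ = 1` and `C (1 - δ⁻¹) = 0` (`multiplier_of_hirzebruchEquation`).

*Some multiplier is not `1`.* Otherwise `F` would be elliptic with one simple pole modulo `Λ`. The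
contradiction is derived without contour integrals (`false_of_odd_of_simple_pole`): the odd
elliptic function `E(t) = F(t) - F(-t)` vanishes at the half-periods, hence `E(t) E(t + ω₁/2)` has
no poles, is constant by Liouville's theorem, and is zero because it vanishes at `ω₂/2`; but `E`
is not identically zero. Hence `C = 0`.

Finally `fⁿ⁺¹` is `Λ`-periodic with zeros and poles of order `n + 1`, so that `f` is an elliptic
function of level `d = n + 1`.
-/

namespace Krichever

/-! ### The Weierstrass functions `σ` and `ζ` -/

lemma isOpen_compl_lattice (L : PeriodPair) : IsOpen (L.lattice : Set ℂ)ᶜ :=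
  L.isClosed_lattice.isOpen_compl

lemma countable_lattice (L : PeriodPair) : (L.lattice : Set ℂ).Countable :=
  countable_of_Lindelof_of_discrete (X := L.lattice)

lemma isPreconnected_compl_of_countable {S : Set ℂ} (hS : S.Countable) : IsPreconnected Sᶜ :=
  (hS.isConnected_compl_of_one_lt_rank (by simp)).2

lemma eventually_notMem_lattice (L : PeriodPair) (z : ℂ) : ∀ᶠ t in 𝓝[≠] z, t ∉ L.lattice := by
  filter_upwards [mem_nhdsWithin_of_mem_nhds (L.compl_lattice_sdiff_singleton_mem_nhds z),
    self_mem_nhdsWithin] with t ht h't hm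
  exact ht ⟨hm, h't⟩

/-- The factor `(1 - z/l) exp (z/l + z²/(2l²))` of the product defining `σ`; it is `1` for
`l = 0`. -/
noncomputable def sigmaFactor (l z : ℂ) : ℂ :=
  (1 - z / l) * Complex.exp (z / l + z ^ 2 / (2 * l ^ 2))

@[simp] lemma sigmaFactor_zero_left (z : ℂ) : sigmaFactor 0 z = 1 := by simp [sigmaFactor]

@[simp] lemma sigmaFactor_zero_right (l : ℂ) : sigmaFactor l 0 = 1 := by simp [sigmaFactor]

lemma differentiable_sigmaFactor (l : ℂ) : Differentiable ℂ (sigmaFactor l) := by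
  unfold sigmaFactor
  fun_prop

lemma sigmaFactor_ne_zero {l z : ℂ} (h : l ≠ z) : sigmaFactor l z ≠ 0 := by
  rcases eq_or_ne l 0 with rfl | hl
  · simp
  · refine mul_ne_zero (fun h0 ↦ h ?_) (Complex.exp_ne_zero _)
    exact (div_eq_one_iff_eq hl).mp (sub_eq_zero.mp h0).symm |>.symm

/-- The elementary estimate `|(1 - w) exp (w + w²/2) - 1| = O(|w|³)` behind the convergence of
the product for `σ`. -/
lemma norm_one_sub_mul_exp_sub_one_le {w : ℂ} (hw : ‖w‖ ≤ 1 / 2) :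
    ‖(1 - w) * Complex.exp (w + w ^ 2 / 2) - 1‖ ≤ 8 * ‖w‖ ^ 3 := by
  set x := w + w ^ 2 / 2 with hx
  have h0 := norm_nonneg w
  have hx2 : ‖x‖ ≤ 5 / 4 * ‖w‖ := by
    calc ‖x‖ ≤ ‖w‖ + ‖w ^ 2 / 2‖ := norm_add_le _ _
      _ = ‖w‖ + ‖w‖ * ‖w‖ / 2 := by simp [pow_two]
      _ ≤ _ := by nlinarith
  have hE : ‖Complex.exp x - (1 + x + x ^ 2 / 2)‖ ≤ 2 * ‖w‖ ^ 3 := by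
    have := Complex.exp_bound (x := x) (by linarith) (n := 3) (by norm_num)
    simp only [Finset.sum_range_succ, Finset.sum_range_zero, Nat.factorial] at this
    norm_num at this
    refine this.trans ?_
    calc ‖x‖ ^ 3 * (2 / 9) ≤ (5 / 4 * ‖w‖) ^ 3 * (2 / 9) := by gcongr
      _ ≤ _ := by nlinarith [pow_nonneg h0 3]
  -- The factor `1 - w` cancels the terms of degree `1` and `2` of `exp (w + w²/2)`.
  have key : (1 - w) * Complex.exp x - 1 =
      (1 - w) * (Complex.exp x - (1 + x + x ^ 2 / 2)) -
        w ^ 3 * (1 / 2 + 3 / 8 * w + w ^ 2 / 8) := by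
    rw [hx]; ring
  rw [key]
  have h1 : ‖1 - w‖ ≤ 2 := (norm_sub_le _ _).trans (by rw [norm_one]; linarith)
  have h2 : ‖1 / 2 + 3 / 8 * w + w ^ 2 / 8‖ ≤ 1 := by
    calc _ ≤ ‖(1 / 2 : ℂ)‖ + ‖3 / 8 * w‖ + ‖w ^ 2 / 8‖ := norm_add₃_le
      _ = 1 / 2 + 3 / 8 * ‖w‖ + ‖w‖ ^ 2 / 8 := by simp
      _ ≤ 1 := by nlinarith
  calc _ ≤ ‖(1 - w) * (Complex.exp x - (1 + x + x ^ 2 / 2))‖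
        + ‖w ^ 3 * (1 / 2 + 3 / 8 * w + w ^ 2 / 8)‖ := norm_sub_le _ _
    _ ≤ 2 * (2 * ‖w‖ ^ 3) + ‖w‖ ^ 3 * 1 := by
      rw [norm_mul, norm_mul, norm_pow]
      gcongr
    _ ≤ _ := by nlinarith [pow_nonneg h0 3]

lemma norm_sigmaFactor_sub_one_le {r : ℝ} {l z : ℂ} (hr : 0 < r) (hz : ‖z‖ ≤ r)
    (hl : 2 * r ≤ ‖l‖) : ‖sigmaFactor l z - 1‖ ≤ 8 * r ^ 3 * ‖l‖⁻¹ ^ 3 := by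
  have hl0 : 0 < ‖l‖ := by linarith
  have hn : ‖z / l‖ ≤ r * ‖l‖⁻¹ := by
    rw [norm_div, div_eq_mul_inv]
    gcongr
  have hw : ‖z / l‖ ≤ 1 / 2 := by
    rw [norm_div, div_le_iff₀ hl0]
    linarith
  have := norm_one_sub_mul_exp_sub_one_le hw
  have e : (z / l) ^ 2 / 2 = z ^ 2 / (2 * l ^ 2) := by rw [div_pow]; ring
  rw [e] at this
  refine this.trans ?_
  calc 8 * ‖z / l‖ ^ 3 ≤ 8 * (r * ‖l‖⁻¹) ^ 3 := by gcongr
    _ = _ := by ring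

lemma summable_norm_inv_cube (L : PeriodPair) : Summable fun l : L.lattice ↦ ‖(l : ℂ)‖⁻¹ ^ 3 :=
  ZLattice.summable_norm_pow_inv L.lattice 3 (by simp)

lemma eventually_le_norm (L : PeriodPair) (r : ℝ) :
    ∀ᶠ l : L.lattice in cofinite, r ≤ ‖(l : ℂ)‖ := by
  rw [← cocompact_eq_cofinite]
  exact (tendsto_norm_cocompact_atTop (E := L.lattice)).eventually_ge_atTop r

lemma eventually_norm_sigmaFactor_sub_one_le (L : PeriodPair) {r : ℝ} (hr : 0 < r) :
    ∀ᶠ l : L.lattice in cofinite, ∀ z : ℂ, ‖z‖ ≤ r →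
      ‖sigmaFactor l z - 1‖ ≤ 8 * r ^ 3 * ‖(l : ℂ)‖⁻¹ ^ 3 := by
  filter_upwards [eventually_le_norm L (2 * r)] with l hl z hz
  exact norm_sigmaFactor_sub_one_le hr hz hl

/-- The product `σ(z) / z`. -/
noncomputable def sigmaProd (L : PeriodPair) (z : ℂ) : ℂ := ∏' l : L.lattice, sigmaFactor l z

lemma sigma_eq (L : PeriodPair) (z : ℂ) : sigma L z = z * sigmaProd L z := rfl

lemma hasProdLocallyUniformlyOn_sigmaProd (L : PeriodPair) :
    HasProdLocallyUniformlyOn (fun (l : L.lattice) z ↦ sigmaFactor l z) (sigmaProd L)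
      Set.univ := by
  refine hasProdLocallyUniformlyOn_of_forall_compact isOpen_univ fun K _ hK ↦ ?_
  obtain ⟨r, hr, hKr⟩ := hK.isBounded.exists_pos_norm_le
  have := ((summable_norm_inv_cube L).mul_left (8 * r ^ 3)).hasProdUniformlyOn_one_add
    (f := fun (l : L.lattice) z ↦ sigmaFactor l z - 1) hK
    (by filter_upwards [eventually_norm_sigmaFactor_sub_one_le L hr] with l hl z hz
        exact hl z (hKr z hz))
    fun l ↦ ((differentiable_sigmaFactor l).continuous.sub continuous_const).continuousOn
  simpa only [add_sub_cancel] using! this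

lemma differentiable_prod_sigmaFactor (L : PeriodPair) (s : Finset L.lattice) :
    Differentiable ℂ fun z ↦ ∏ l ∈ s, sigmaFactor (l : ℂ) z :=
  Differentiable.fun_finsetProd fun l _ ↦ differentiable_sigmaFactor (l : ℂ)

lemma differentiable_sigmaProd (L : PeriodPair) : Differentiable ℂ (sigmaProd L) := by
  rw [← differentiableOn_univ]
  exact (hasProdLocallyUniformlyOn_sigmaProd L).differentiableOn
    (.of_forall fun s ↦ (differentiable_prod_sigmaFactor L s).differentiableOn) isOpen_univ

lemma differentiable_sigma (L : PeriodPair) : Differentiable ℂ (sigma L) :=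
  differentiable_id.mul (differentiable_sigmaProd L)

@[simp] lemma sigmaProd_zero (L : PeriodPair) : sigmaProd L 0 = 1 := by simp [sigmaProd]

lemma sigmaProd_ne_zero (L : PeriodPair) {z : ℂ} (hz : z ∉ L.lattice) : sigmaProd L z ≠ 0 := by
  have h := tprod_one_add_ne_zero_of_summable (f := fun l : L.lattice ↦ sigmaFactor l z - 1)
    (fun l ↦ by
      rw [add_sub_cancel]
      exact sigmaFactor_ne_zero fun h ↦ hz (h ▸ l.2)) ?_
  · simpa only [add_sub_cancel] using! h
  · refine ((summable_norm_inv_cube L).mul_left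
      (8 * (‖z‖ + 1) ^ 3)).of_norm_bounded_eventually ?_
    filter_upwards [eventually_norm_sigmaFactor_sub_one_le L
      (r := ‖z‖ + 1) (by positivity)] with l hl
    simpa using hl z (by linarith)

lemma sigma_ne_zero (L : PeriodPair) {z : ℂ} (hz : z ∉ L.lattice) : sigma L z ≠ 0 :=
  mul_ne_zero (fun h ↦ hz (h ▸ zero_mem _)) (sigmaProd_ne_zero L hz)

/-- The summands of `ζ`. -/
noncomputable def zetaTerm (l z : ℂ) : ℂ := 1 / (z - l) + 1 / l + z / l ^ 2

/-- The identity `1/(z - l) + 1/l + z/l² = z²/(l²(z - l))` shows the cubic decay in `l`. -/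
lemma norm_zetaTerm_le {r : ℝ} {l z : ℂ} (hr : 0 < r) (hz : ‖z‖ < r) (hl : 2 * r ≤ ‖l‖) :
    ‖zetaTerm l z‖ ≤ 2 * r ^ 2 * ‖l‖⁻¹ ^ 3 := by
  have hl0 : 0 < ‖l‖ := by linarith
  have hl1 : l ≠ 0 := norm_pos_iff.mp hl0
  have hd : ‖l‖ / 2 ≤ ‖z - l‖ := by
    rw [norm_sub_rev]
    linarith [norm_sub_norm_le l z]
  have hd0 : z - l ≠ 0 := norm_pos_iff.mp (by linarith)
  have e : zetaTerm l z = z ^ 2 / (l ^ 2 * (z - l)) := by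
    unfold zetaTerm
    field_simp
    ring
  rw [e, norm_div, norm_mul, norm_pow, norm_pow, div_le_iff₀ (by positivity)]
  calc ‖z‖ ^ 2 ≤ r ^ 2 := by gcongr
    _ = 2 * r ^ 2 * ‖l‖⁻¹ ^ 3 * (‖l‖ ^ 2 * (‖l‖ / 2)) := by field_simp
    _ ≤ _ := by gcongr

lemma hasSumLocallyUniformly_zeta (L : PeriodPair) :
    HasSumLocallyUniformly (fun (l : L.lattice) z ↦ zetaTerm l z) (zeta L) :=
  L.hasSumLocallyUniformly_aux _ (fun r l ↦ 2 * r ^ 2 * ‖(l : ℂ)‖⁻¹ ^ 3)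
    (fun _ _ ↦ (summable_norm_inv_cube L).mul_left _) fun r hr ↦
    eventually_atTop.mpr ⟨2 * r, fun _ hR _ hz _ hl ↦ norm_zetaTerm_le hr hz (hl ▸ hR)⟩

lemma hasDerivAt_zetaTerm {l z : ℂ} (h : z ≠ l) :
    HasDerivAt (zetaTerm l) (-(1 / (z - l) ^ 2 - 1 / l ^ 2)) z := by
  have h1 : HasDerivAt (fun z : ℂ ↦ 1 / (z - l)) (-1 / (z - l) ^ 2) z := by
    simpa using! ((hasDerivAt_id z).sub_const l).inv (sub_ne_zero.mpr h)
  convert! (h1.add_const (1 / l)).add ((hasDerivAt_id z).div_const (l ^ 2)) using 1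
  ring

lemma hasDerivAt_zeta (L : PeriodPair) {z : ℂ} (hz : z ∉ L.lattice) :
    HasDerivAt (zeta L) (-L.weierstrassP z) z := by
  have hne (l : L.lattice) {x : ℂ} (hx : x ∈ (L.lattice : Set ℂ)ᶜ) : x ≠ l :=
    fun h ↦ hx (h ▸ l.2)
  have hd : ∀ᶠ s : Finset L.lattice in atTop,
      DifferentiableOn ℂ (fun z ↦ ∑ l ∈ s, zetaTerm l z) (L.lattice : Set ℂ)ᶜ :=
    .of_forall fun s ↦ DifferentiableOn.fun_sum fun l _ x hx ↦
      (hasDerivAt_zetaTerm (hne l hx)).differentiableAt.differentiableWithinAt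
  have hs := (hasSumLocallyUniformly_zeta L).hasSumLocallyUniformlyOn
    (s := (L.lattice : Set ℂ)ᶜ)
  have hdiff := (hs.differentiableOn hd (isOpen_compl_lattice L) z hz).differentiableAt
    ((isOpen_compl_lattice L).mem_nhds hz)
  have ht := (TendstoLocallyUniformlyOn.deriv hs hd (isOpen_compl_lattice L)).tendsto_at hz
  have h2 : Tendsto (fun s : Finset L.lattice ↦ ∑ l ∈ s, -(1 / (z - l) ^ 2 - 1 / (l : ℂ) ^ 2))
      atTop (𝓝 (-L.weierstrassP z)) := (L.hasSum_weierstrassP z).neg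
  have heq : deriv (zeta L) z = -L.weierstrassP z := by
    refine tendsto_nhds_unique ht (h2.congr fun s ↦ ?_)
    exact ((HasDerivAt.fun_sum fun l _ ↦ hasDerivAt_zetaTerm (hne l hz)).deriv).symm
  exact heq ▸ hdiff.hasDerivAt

lemma logDeriv_sigmaFactor {l z : ℂ} (hl : l ≠ 0) (hz : z ≠ l) :
    logDeriv (sigmaFactor l) z = zetaTerm l z := by
  have h1 : HasDerivAt (sigmaFactor l) ((-(1 / l)) * Complex.exp (z / l + z ^ 2 / (2 * l ^ 2)) +
      (1 - z / l) * (Complex.exp (z / l + z ^ 2 / (2 * l ^ 2)) * (1 / l + 2 * z / (2 * l ^ 2))))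
      z := by
    refine HasDerivAt.mul ?_ (HasDerivAt.cexp (HasDerivAt.add ?_ ?_))
    · exact ((hasDerivAt_id z).div_const l).const_sub 1
    · exact (hasDerivAt_id z).div_const l
    · simpa using! (hasDerivAt_pow 2 z).div_const (2 * l ^ 2)
  have hzl : z - l ≠ 0 := sub_ne_zero.mpr hz
  have hlz : l - z ≠ 0 := sub_ne_zero.mpr hz.symm
  rw [logDeriv_apply, h1.deriv, sigmaFactor, zetaTerm, div_eq_iff]
  · have := Complex.exp_ne_zero (z / l + z ^ 2 / (2 * l ^ 2))
    generalize Complex.exp (z / l + z ^ 2 / (2 * l ^ 2)) = e at *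
    field_simp
    ring
  · exact sigmaFactor_ne_zero hz.symm

/-- The logarithmic derivative of `σ` is `ζ`, off the lattice. -/
lemma logDeriv_sigma (L : PeriodPair) {z : ℂ} (hz : z ∉ L.lattice) :
    logDeriv (sigma L) z = zeta L z := by
  have hne (l : L.lattice) : z ≠ l := fun h ↦ hz (h ▸ l.2)
  have hz0 : z ≠ 0 := fun h ↦ hz (h ▸ zero_mem _)
  have ht := Complex.logDeriv_tendsto isOpen_univ (Set.mem_univ z)
    (hasProdLocallyUniformlyOn_sigmaProd L)
    (.of_forall fun s ↦ (differentiable_prod_sigmaFactor L s).differentiableOn)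
    (sigmaProd_ne_zero L hz)
  have hs : Tendsto (fun s : Finset L.lattice ↦ ∑ l ∈ s, zetaTerm l z) atTop (𝓝 (zeta L z)) :=
    (hasSumLocallyUniformly_zeta L).hasSum
  have key : zeta L z - 1 / z = logDeriv (sigmaProd L) z := by
    refine tendsto_nhds_unique ((hs.sub_const (1 / z)).congr' ?_) ht
    -- The term of `ζ` at `l = 0` is `1 / z`, whereas the factor of `σ(z) / z` at `l = 0` is `1`.
    filter_upwards [eventually_ge_atTop {(0 : L.lattice)}] with s hs0
    have hmem : (0 : L.lattice) ∈ s := hs0 (Finset.mem_singleton_self _)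
    have hprod : logDeriv (fun x ↦ ∏ l ∈ s, sigmaFactor (l : ℂ) x) z =
        ∑ l ∈ s, logDeriv (sigmaFactor (l : ℂ)) z := by
      rw [← logDeriv_prod (fun l _ ↦ sigmaFactor_ne_zero (hne l).symm)
        (fun l _ ↦ differentiable_sigmaFactor (l : ℂ) z)]
    have e0 : zetaTerm ((0 : L.lattice) : ℂ) z = 1 / z := by simp [zetaTerm]
    have e1 : logDeriv (sigmaFactor ((0 : L.lattice) : ℂ)) z = 0 := by
      have : sigmaFactor ((0 : L.lattice) : ℂ) = fun _ ↦ 1 := by ext; simp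
      rw [this, logDeriv_const]
      rfl
    trans logDeriv (fun x ↦ ∏ l ∈ s, sigmaFactor (l : ℂ) x) z
    · rw [hprod, ← Finset.add_sum_erase _ _ hmem, ← Finset.add_sum_erase _ _ hmem, e0, e1,
        add_sub_cancel_left, zero_add]
      refine Finset.sum_congr rfl fun l hl ↦ (logDeriv_sigmaFactor ?_ (hne l)).symm
      simpa using Finset.ne_of_mem_erase hl
    · rfl
  have : logDeriv (sigma L) z = 1 / z + logDeriv (sigmaProd L) z := by
    have := logDeriv_mul (f := fun z : ℂ ↦ z) (g := sigmaProd L) z hz0 (sigmaProd_ne_zero L hz)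
      differentiableAt_id (differentiable_sigmaProd L z)
    rw [logDeriv_id'] at this
    exact this
  rw [this, ← key]
  ring

/-- `ζ(z + w) - ζ(z)` is a constant `η`, because `ζ' = -℘` is `Λ`-periodic. -/
lemma exists_zeta_add (L : PeriodPair) {w : ℂ} (hw : w ∈ L.lattice) :
    ∃ η : ℂ, ∀ z, z ∉ L.lattice → zeta L (z + w) = zeta L z + η := by
  have hmem {z : ℂ} (hz : z ∈ (L.lattice : Set ℂ)ᶜ) : z + w ∉ L.lattice :=
    fun h ↦ hz ((L.lattice.add_mem_iff_left hw).mp h)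
  have hd {z : ℂ} (hz : z ∈ (L.lattice : Set ℂ)ᶜ) :
      HasDerivAt (fun z ↦ zeta L (z + w) - zeta L z) 0 z := by
    have h1 := (hasDerivAt_zeta L (hmem hz)).comp_add_const z w
    convert! h1.sub (hasDerivAt_zeta L hz) using 1
    rw [L.weierstrassP_add_coe z ⟨w, hw⟩, sub_self]
  obtain ⟨η, hη⟩ := (isOpen_compl_lattice L).exists_is_const_of_deriv_eq_zero
    (isPreconnected_compl_of_countable (countable_lattice L))
    (fun z hz ↦ (hd hz).differentiableAt.differentiableWithinAt) fun z hz ↦ (hd hz).deriv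
  exact ⟨η, fun z hz ↦ by rw [← hη z hz]; ring⟩

/-- Quasi-periodicity of the Weierstrass `σ`-function. -/
lemma exists_sigma_add (L : PeriodPair) {w : ℂ} (hw : w ∈ L.lattice) :
    ∃ c η : ℂ, c ≠ 0 ∧ ∀ z, sigma L (z + w) = c * Complex.exp (η * z) * sigma L z := by
  obtain ⟨η, hη⟩ := exists_zeta_add L hw
  have hmem {z : ℂ} (hz : z ∈ (L.lattice : Set ℂ)ᶜ) : z + w ∉ L.lattice :=
    fun h ↦ hz ((L.lattice.add_mem_iff_left hw).mp h)
  have hσ := differentiable_sigma L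
  have hf : Differentiable ℂ fun z ↦ sigma L (z + w) := hσ.comp (differentiable_id.add_const w)
  have he : Differentiable ℂ fun z ↦ Complex.exp (η * z) := by fun_prop
  have hg : Differentiable ℂ fun z ↦ Complex.exp (η * z) * sigma L z := he.mul hσ
  have hlog : Set.EqOn (logDeriv fun z ↦ sigma L (z + w))
      (logDeriv fun z ↦ Complex.exp (η * z) * sigma L z) (L.lattice : Set ℂ)ᶜ := by
    intro z hz
    have h1 : logDeriv (fun z ↦ sigma L (z + w)) z = zeta L (z + w) := by
      rw [← logDeriv_sigma L (hmem hz)]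
      simp only [logDeriv_apply, deriv_comp_add_const]
    have h2 : logDeriv (fun z ↦ Complex.exp (η * z)) z = η := by
      have : HasDerivAt (fun z ↦ Complex.exp (η * z)) (Complex.exp (η * z) * (η * 1)) z :=
        ((hasDerivAt_id z).const_mul η).cexp
      rw [logDeriv_apply, this.deriv, mul_one, mul_div_cancel_left₀ _ (Complex.exp_ne_zero _)]
    rw [h1, hη z hz, logDeriv_mul (f := fun z ↦ Complex.exp (η * z)) z
      (Complex.exp_ne_zero _) (sigma_ne_zero L hz) (he z) (hσ z), h2,
      logDeriv_sigma L hz, add_comm]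
  obtain ⟨c, hc, hc'⟩ := (logDeriv_eqOn_iff hf.differentiableOn hg.differentiableOn
    (isOpen_compl_lattice L) (isPreconnected_compl_of_countable (countable_lattice L))
    (fun z hz ↦ mul_ne_zero (Complex.exp_ne_zero _) (sigma_ne_zero L hz))
    (fun z hz ↦ sigma_ne_zero L (hmem hz))).mp hlog
  refine ⟨c, η, hc, fun z ↦ ?_⟩
  have hdense : Dense (L.lattice : Set ℂ)ᶜ := (countable_lattice L).dense_compl ℂ
  have := Continuous.ext_on hdense hf.continuous (hg.continuous.const_smul c) hc'
  simpa [mul_assoc] using congrFun this z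

@[simp] lemma sigma_zero (L : PeriodPair) : sigma L 0 = 0 := by simp [sigma_eq]

/-! ### Zeros, poles and quasi-periodicity of `f` -/

variable {L : PeriodPair} {s α : ℂ}

/-- `f` as a quotient of entire functions; division by zero makes this an identity at every
point. -/
lemma kricheverFun_eq (L : PeriodPair) (s α t : ℂ) : kricheverFun L s α t =
    sigma L s * sigma L t * Complex.exp ((α - zeta L s) * t) / sigma L (s - t) := by
  rw [kricheverFun, bakerAkhiezer, sub_mul, Complex.exp_sub]
  simp only [div_eq_mul_inv, mul_inv, inv_inv]
  ring

lemma one_div_kricheverFun (L : PeriodPair) (s α t : ℂ) : 1 / kricheverFun L s α t =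
    sigma L (s - t) / (sigma L s * sigma L t * Complex.exp ((α - zeta L s) * t)) := by
  rw [kricheverFun_eq, one_div_div]

/-- With division by zero, `f` takes the correct value at its zero `0`, where `Φ_s` has a pole. -/
@[simp] lemma kricheverFun_zero : kricheverFun L s α 0 = 0 := by simp [kricheverFun_eq]

lemma differentiable_sigma_const_sub (L : PeriodPair) (s : ℂ) :
    Differentiable ℂ fun t ↦ sigma L (s - t) :=
  (differentiable_sigma L).comp (differentiable_id.const_sub s)

lemma differentiable_sigma_mul_exp (L : PeriodPair) (s β : ℂ) :
    Differentiable ℂ fun t ↦ sigma L s * sigma L t * Complex.exp (β * t) := by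
  have := differentiable_sigma L
  fun_prop

lemma kricheverFun_ne_zero (hs : s ∉ L.lattice) {t : ℂ} (ht : t ∉ L.lattice)
    (hst : s - t ∉ L.lattice) : kricheverFun L s α t ≠ 0 := by
  rw [kricheverFun_eq]
  exact div_ne_zero (mul_ne_zero (mul_ne_zero (sigma_ne_zero L hs) (sigma_ne_zero L ht))
    (Complex.exp_ne_zero _)) (sigma_ne_zero L hst)

lemma differentiableAt_kricheverFun {t : ℂ} (hst : s - t ∉ L.lattice) :
    DifferentiableAt ℂ (kricheverFun L s α) t := by
  rw [funext (kricheverFun_eq L s α)]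
  exact (differentiable_sigma_mul_exp L s _ t).div (differentiable_sigma_const_sub L s t)
    (sigma_ne_zero L hst)

lemma differentiableAt_one_div_kricheverFun (hs : s ∉ L.lattice) {t : ℂ} (ht : t ∉ L.lattice) :
    DifferentiableAt ℂ (fun t ↦ 1 / kricheverFun L s α t) t := by
  rw [funext (one_div_kricheverFun L s α)]
  exact (differentiable_sigma_const_sub L s t).div (differentiable_sigma_mul_exp L s _ t)
    (mul_ne_zero (mul_ne_zero (sigma_ne_zero L hs) (sigma_ne_zero L ht)) (Complex.exp_ne_zero _))

lemma meromorphic_kricheverFun (L : PeriodPair) (s α : ℂ) : Meromorphic (kricheverFun L s α) := by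
  intro z
  rw [funext (kricheverFun_eq L s α)]
  exact ((differentiable_sigma_mul_exp L s _).analyticAt z).meromorphicAt.fun_div
    ((differentiable_sigma_const_sub L s).analyticAt z).meromorphicAt

/-- `f` is quasi-periodic: a shift by a period multiplies it by a nonzero constant. -/
lemma exists_kricheverFun_add (s α : ℂ) {w : ℂ} (hw : w ∈ L.lattice) :
    ∃ δ : ℂ, δ ≠ 0 ∧ ∀ t, kricheverFun L s α (t + w) = δ * kricheverFun L s α t := by
  obtain ⟨c, η, hc, h⟩ := exists_sigma_add L hw
  refine ⟨c ^ 2 * Complex.exp (η * (s - w) + (α - zeta L s) * w),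
    mul_ne_zero (pow_ne_zero 2 hc) (Complex.exp_ne_zero _), fun t ↦ ?_⟩
  have h1 : sigma L (s - t) = c * Complex.exp (η * (s - (t + w))) * sigma L (s - (t + w)) := by
    rw [← h]
    ring_nf
  have he : Complex.exp (η * (s - w) + (α - zeta L s) * w) * Complex.exp ((α - zeta L s) * t) =
      Complex.exp (η * t) * Complex.exp ((α - zeta L s) * (t + w)) *
        Complex.exp (η * (s - (t + w))) := by
    rw [← Complex.exp_add, ← Complex.exp_add, ← Complex.exp_add]
    ring_nf
  rw [kricheverFun_eq, kricheverFun_eq, h t, h1]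
  have hE := Complex.exp_ne_zero (η * (s - (t + w)))
  generalize Complex.exp (η * (s - (t + w))) = E at *
  rw [← mul_div_assoc]
  rw [show c ^ 2 * Complex.exp (η * (s - w) + (α - zeta L s) * w) *
      (sigma L s * sigma L t * Complex.exp ((α - zeta L s) * t)) = c ^ 2 * (sigma L s * sigma L t) *
      (Complex.exp (η * (s - w) + (α - zeta L s) * w) * Complex.exp ((α - zeta L s) * t)) by ring,
    he]
  rcases eq_or_ne (sigma L (s - (t + w))) 0 with h0 | h0
  · simp [h0]
  · field_simp

lemma eventually_sub_notMem_lattice (hs : s ∉ L.lattice) :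
    ∀ᶠ t in 𝓝 (0 : ℂ), s - t ∉ L.lattice := by
  have : ContinuousAt (fun t : ℂ ↦ s - t) 0 := by fun_prop
  exact this.eventually ((isOpen_compl_lattice L).mem_nhds (by simpa using hs))

/-- `f(t) = t + ⋯` at `0`. -/
lemma tendsto_kricheverFun_div (hs : s ∉ L.lattice) :
    Tendsto (fun t ↦ kricheverFun L s α t / t) (𝓝[≠] 0) (𝓝 1) := by
  have hσ := sigma_ne_zero L hs
  have hc : ContinuousAt (fun t ↦ sigma L s * sigmaProd L t * Complex.exp ((α - zeta L s) * t) /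
      sigma L (s - t)) 0 := by
    have h1 := (differentiable_sigmaProd L).continuous
    refine ContinuousAt.div (by fun_prop)
      (differentiable_sigma_const_sub L s).continuous.continuousAt (by simpa using hσ)
  have ht := hc.tendsto.mono_left (nhdsWithin_le_nhds (s := {0}ᶜ))
  simp only [sigmaProd_zero, mul_zero, Complex.exp_zero, mul_one, sub_zero, div_self hσ] at ht
  refine ht.congr' ?_
  filter_upwards [self_mem_nhdsWithin] with t (ht : t ≠ 0)
  rw [kricheverFun_eq, sigma_eq L t]
  field_simp

lemma meromorphicOrderAt_kricheverFun_zero (hs : s ∉ L.lattice) :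
    meromorphicOrderAt (kricheverFun L s α) 0 = 1 := by
  have hm := meromorphic_kricheverFun L s α 0
  have h0 := (tendsto_ne_zero_iff_meromorphicOrderAt_eq_zero (hm.fun_div (.id 0))).mp
    ⟨1, one_ne_zero, tendsto_kricheverFun_div hs⟩
  have h1 : meromorphicOrderAt (kricheverFun L s α) 0 =
      meromorphicOrderAt (fun t ↦ (kricheverFun L s α t / t) * t) 0 := by
    refine meromorphicOrderAt_congr ?_
    filter_upwards [self_mem_nhdsWithin] with t (ht : t ≠ 0)
    rw [div_mul_cancel₀ _ ht]
  rw [h1]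
  exact (fun_meromorphicOrderAt_mul (hm.fun_div (.id 0)) (.id 0)).trans
    (by rw [h0, zero_add, meromorphicOrderAt_id])

/-- `f` has a simple pole at `s`, where `σ(s - t)` has a simple zero. -/
lemma meromorphicOrderAt_kricheverFun_pole (hs : s ∉ L.lattice) :
    meromorphicOrderAt (kricheverFun L s α) s = -1 := by
  set g : ℂ → ℂ := fun t ↦ sigma L s * sigma L t * Complex.exp ((α - zeta L s) * t) *
    (-sigmaProd L (s - t))⁻¹ with hg
  have hP : Differentiable ℂ fun t ↦ -sigmaProd L (s - t) :=
    ((differentiable_sigmaProd L).comp (differentiable_id.const_sub s)).neg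
  have hga : AnalyticAt ℂ g s :=
    ((differentiable_sigma_mul_exp L s _).analyticAt s).mul ((hP.analyticAt s).inv (by simp))
  have : ((-1 : ℤ) : WithTop ℤ) = -1 := rfl
  rw [← this, meromorphicOrderAt_eq_int_iff (meromorphic_kricheverFun L s α s)]
  refine ⟨g, hga, ?_, ?_⟩
  · simp [hg, sigma_ne_zero L hs]
  · filter_upwards [self_mem_nhdsWithin] with t (ht : t ≠ s)
    have h1 : t - s ≠ 0 := sub_ne_zero.mpr ht
    have h2 : s - t ≠ 0 := sub_ne_zero.mpr ht.symm
    rw [kricheverFun_eq, sigma_eq L (s - t), zpow_neg_one, smul_eq_mul]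
    simp only [hg, div_eq_mul_inv, mul_inv, inv_neg]
    rw [show (t - s)⁻¹ = -(s - t)⁻¹ by rw [← inv_neg, neg_sub]]
    ring

lemma meromorphicOrderAt_kricheverFun_of_notMem (hs : s ∉ L.lattice) {t : ℂ} (ht : t ∉ L.lattice)
    (hts : t - s ∉ L.lattice) : meromorphicOrderAt (kricheverFun L s α) t = 0 := by
  have hst : s - t ∉ L.lattice := fun h ↦ hts (by simpa using neg_mem h)
  rw [← tendsto_ne_zero_iff_meromorphicOrderAt_eq_zero (meromorphic_kricheverFun L s α t)]
  exact ⟨_, kricheverFun_ne_zero (α := α) hs ht hst,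
    (differentiableAt_kricheverFun hst).continuousAt.tendsto.mono_left nhdsWithin_le_nhds⟩

/-- If all multipliers of `f` are `n`-th roots of unity, then `f ^ n` is elliptic and `f` is an
elliptic function of level `n` whose only pole modulo `Λ` is `s`. -/
lemma isEllipticOfLevel_kricheverFun (hs : s ∉ L.lattice) {n : ℕ} (hn : 1 < n)
    (h : ∀ w ∈ L.lattice, ∀ t, kricheverFun L s α (t + w) ^ n = kricheverFun L s α t ^ n) :
    IsEllipticOfLevel L n (kricheverFun L s α) := by
  have hm := meromorphic_kricheverFun L s α
  refine ⟨hn, hm, tendsto_kricheverFun_div hs, s, fun t ↦ kricheverFun L s α t ^ n,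
    ⟨fun z ↦ (hm z).fun_pow n, h, hs, ?_, ?_, fun t ht hts ↦ ?_, ?_⟩, EventuallyEq.rfl⟩
  · rw [fun_meromorphicOrderAt_pow (hm 0), meromorphicOrderAt_kricheverFun_zero hs, mul_one]
    rfl
  · rw [fun_meromorphicOrderAt_pow (hm s), meromorphicOrderAt_kricheverFun_pole hs]
    change ((n : ℤ) : WithTop ℤ) * ((-1 : ℤ) : WithTop ℤ) = _
    rw [← WithTop.coe_mul, mul_neg_one]
  · rw [fun_meromorphicOrderAt_pow (hm t), meromorphicOrderAt_kricheverFun_of_notMem hs ht hts,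
      mul_zero]
  · simpa [div_pow] using (tendsto_kricheverFun_div (α := α) hs).pow n

/-! ### Elliptic functions with at most one simple pole -/

/-- A continuous doubly periodic function is bounded. -/
lemma isBounded_range_of_periodic (L : PeriodPair) {K : ℂ → ℂ} (hK : Continuous K)
    (hper : ∀ w ∈ L.lattice, ∀ t, K (t + w) = K t) : Bornology.IsBounded (Set.range K) := by
  have hcpt := (ZSpan.fundamentalDomain_isBounded L.basis).isCompact_closure
  refine (hcpt.image hK).isBounded.subset ?_
  rintro _ ⟨t, rfl⟩
  refine ⟨ZSpan.fract L.basis t, subset_closure (ZSpan.fract_mem_fundamentalDomain _ _), ?_⟩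
  rw [ZSpan.fract_apply, sub_eq_add_neg]
  refine hper _ (neg_mem ?_) t
  rw [L.lattice_eq_span_range_basis]
  exact (ZSpan.floor L.basis t).2

/-- Liouville's theorem for elliptic functions: without poles, they are constant. -/
lemma exists_eventuallyEq_const_of_periodic (L : PeriodPair) {K : ℂ → ℂ} (hK : Meromorphic K)
    (hper : ∀ w ∈ L.lattice, ∀ t, K (t + w) = K t) (hord : ∀ t, 0 ≤ meromorphicOrderAt K t) :
    ∃ c, ∀ t, K =ᶠ[𝓝[≠] t] fun _ ↦ c := by
  have hKu : MeromorphicOn K Set.univ := meromorphicOn_univ.mpr hK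
  set G := toMeromorphicNFOn K Set.univ with hG
  have hGK (t : ℂ) : G =ᶠ[𝓝[≠] t] K := hKu.toMeromorphicNFOn_eq_self_on_nhdsNE (Set.mem_univ t)
  have hGa (t : ℂ) : AnalyticAt ℂ G t := by
    rw [← (meromorphicNFOn_toMeromorphicNFOn K Set.univ
      (Set.mem_univ t)).meromorphicOrderAt_nonneg_iff_analyticAt,
      meromorphicOrderAt_toMeromorphicNFOn hKu (Set.mem_univ t)]
    exact hord t
  have hGd : Differentiable ℂ G := fun t ↦ (hGa t).differentiableAt
  have hGper (w : ℂ) (hw : w ∈ L.lattice) (t : ℂ) : G (t + w) = G t := by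
    have hshift : Tendsto (fun z : ℂ ↦ z + w) (𝓝[≠] t) (𝓝[≠] (t + w)) := by
      refine tendsto_nhdsWithin_of_tendsto_nhds_of_eventually_within _
        ((continuous_add_const w).continuousAt.tendsto.mono_left nhdsWithin_le_nhds) ?_
      filter_upwards [self_mem_nhdsWithin] with z hz
      simpa using hz
    have hev : (fun z ↦ G (z + w)) =ᶠ[𝓝[≠] t] G := by
      filter_upwards [hshift.eventually (hGK (t + w)), hGK t] with z h1 h2
      rw [h1, h2, hper w hw]
    have hc : ContinuousAt (fun z ↦ G (z + w)) t :=
      (hGd.continuous.comp (continuous_add_const w)).continuousAt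
    exact ((hc.eventuallyEq_nhds_iff_eventuallyEq_nhdsNE
      hGd.continuous.continuousAt).mp hev).eq_of_nhds
  have hb := isBounded_range_of_periodic L hGd.continuous hGper
  refine ⟨G 0, fun t ↦ ?_⟩
  filter_upwards [hGK t] with z hz
  rw [← hz]
  exact hGd.apply_eq_apply_of_bounded hb z 0

/-- There is no odd elliptic function whose only pole modulo the period lattice is a simple
pole at the origin. Such a function `E` vanishes at the half-periods `ω₁/2` and `ω₂/2`, so the
poles of `E(t) E(t + ω₁/2)` cancel; this product is then constant and vanishes at `t = ω₂/2`. -/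
lemma false_of_odd_of_simple_pole (L : PeriodPair) {E : ℂ → ℂ} (hE : Meromorphic E)
    (hper : ∀ w ∈ L.lattice, ∀ t, E (t + w) = E t) (hodd : ∀ t, E (-t) = -E t)
    (hdiff : ∀ t, t ∉ L.lattice → DifferentiableAt ℂ E t) (hord : meromorphicOrderAt E 0 = -1) :
    False := by
  have han {t : ℂ} (ht : t ∉ L.lattice) : AnalyticAt ℂ E t := by
    have : DifferentiableOn ℂ E (L.lattice : Set ℂ)ᶜ :=
      fun z hz ↦ (hdiff z hz).differentiableWithinAt
    exact this.analyticAt ((isOpen_compl_lattice L).mem_nhds ht)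
  have hhalf {w : ℂ} (hw : w ∈ L.lattice) : E (w / 2) = 0 := by
    have h1 := hper w hw (-(w / 2))
    rw [hodd, show -(w / 2) + w = w / 2 by ring] at h1
    linear_combination h1 / 2
  set h := L.ω₁ / 2 with hh
  have hhL : h ∉ L.lattice := L.ω₁_div_two_notMem_lattice
  have hEh (t : ℂ) : MeromorphicAt (fun t ↦ E (t + h)) t := by
    have := meromorphicAt_comp_add_const_iff_meromorphicAt.mpr (hE (t + h))
    exact this
  have hordh (t : ℂ) : meromorphicOrderAt (fun t ↦ E (t + h)) t = meromorphicOrderAt E (t + h) :=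
    meromorphicOrderAt_fun_comp_add_const_eq_meromorphicOrderAt
  set K : ℂ → ℂ := fun t ↦ E t * E (t + h) with hKdef
  have hK : Meromorphic K := fun t ↦ (hE t).fun_mul (hEh t)
  have hKord (t : ℂ) : meromorphicOrderAt K t =
      meromorphicOrderAt E t + meromorphicOrderAt E (t + h) := by
    rw [← hordh, ← fun_meromorphicOrderAt_mul (hE t) (hEh t)]
  have hKper (w : ℂ) (hw : w ∈ L.lattice) (t : ℂ) : K (t + w) = K t := by
    simp only [hKdef]
    rw [hper w hw, add_right_comm, hper w hw]
  have hKh (t : ℂ) : K (t + h) = K t := by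
    simp only [hKdef]
    rw [show t + h + h = t + L.ω₁ by rw [hh]; ring, hper _ L.ω₁_mem_lattice, mul_comm]
  have hK0 : 0 ≤ meromorphicOrderAt K 0 := by
    have h1 : 0 < meromorphicOrderAt E h := by
      rw [← tendsto_zero_iff_meromorphicOrderAt_pos (hE h)]
      have := (han hhL).continuousAt.tendsto.mono_left (nhdsWithin_le_nhds (s := {h}ᶜ))
      rwa [hhalf L.ω₁_mem_lattice] at this
    rw [hKord, zero_add, hord]
    cases hx : meromorphicOrderAt E h with
    | top => simp
    | coe n =>
      rw [hx] at h1
      have h2 : 0 < n := by exact_mod_cast h1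
      change ((0 : ℤ) : WithTop ℤ) ≤ ((-1 : ℤ) : WithTop ℤ) + (n : WithTop ℤ)
      rw [← WithTop.coe_add, WithTop.coe_le_coe]
      omega
  have hshift {a : ℂ} (ha : ∀ t, K (t + a) = K t) (t : ℂ) :
      meromorphicOrderAt K (t + a) = meromorphicOrderAt K t := by
    rw [← meromorphicOrderAt_fun_comp_add_const_eq_meromorphicOrderAt]
    simp only [ha]
  have hKL {t : ℂ} (ht : t ∈ L.lattice) : 0 ≤ meromorphicOrderAt K t := by
    have := hshift (hKper t ht) 0
    rw [zero_add] at this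
    rwa [this]
  have hKnonneg (t : ℂ) : 0 ≤ meromorphicOrderAt K t := by
    by_cases ht : t ∈ L.lattice
    · exact hKL ht
    by_cases hth : t + h ∈ L.lattice
    · rw [← hshift hKh t]
      exact hKL hth
    rw [hKord]
    exact add_nonneg (han ht).meromorphicOrderAt_nonneg (han hth).meromorphicOrderAt_nonneg
  obtain ⟨c, hc⟩ := exists_eventuallyEq_const_of_periodic L hK hKper hKnonneg
  -- The constant is the value at the half-period `ω₂/2`, at which `K` is continuous.
  have hc0 : c = 0 := by
    have h2 : L.ω₂ / 2 + h ∉ L.lattice := by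
      intro hm
      have := (L.mul_ω₁_add_mul_ω₂_mem_lattice (α := 1 / 2) (β := 1 / 2)).mp
        (by push_cast; convert! hm using 1; rw [hh]; ring)
      norm_num at this
    have hcont : ContinuousAt K (L.ω₂ / 2) := by
      refine (han L.ω₂_div_two_notMem_lattice).continuousAt.mul ?_
      exact ContinuousAt.comp (f := fun t ↦ t + h) (han h2).continuousAt (by fun_prop)
    have heq := ((hcont.eventuallyEq_nhds_iff_eventuallyEq_nhdsNE
      continuousAt_const).mp (hc (L.ω₂ / 2))).eq_of_nhds
    rw [← heq]
    simp only [hKdef]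
    rw [hhalf L.ω₂_mem_lattice, zero_mul]
  have htop : meromorphicOrderAt K 0 = ⊤ := by
    rw [meromorphicOrderAt_eq_top_iff]
    exact hc0 ▸ hc 0
  rw [hKord, zero_add, WithTop.add_eq_top] at htop
  have h0 : meromorphicOrderAt E 0 ≠ ⊤ := by
    rw [hord]
    exact WithTop.coe_ne_top (a := (-1 : ℤ))
  rcases htop with h1 | h1
  · exact h0 h1
  · exact (meromorphicOn_univ.mpr hE).meromorphicOrderAt_ne_top_of_isPreconnected
      isPreconnected_univ (Set.mem_univ 0) (Set.mem_univ h) h0 h1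

/-- `f` is not `Λ`-periodic: otherwise `1 / f(t) - 1 / f(-t)` would be an odd elliptic function
with a single simple pole. -/
lemma exists_kricheverFun_add_ne (hs : s ∉ L.lattice) :
    ∃ w ∈ L.lattice, ∃ t, kricheverFun L s α (t + w) ≠ kricheverFun L s α t := by
  by_contra! hcon
  set f := kricheverFun L s α with hf
  have hm : Meromorphic fun t ↦ 1 / f t := fun t ↦
    (MeromorphicAt.const 1 t).fun_div (meromorphic_kricheverFun L s α t)
  have hmneg : Meromorphic fun t ↦ 1 / f (-t) := fun t ↦
    (hm (-t)).comp_analyticAt (g := fun t ↦ -t) (by fun_prop)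
  have hlim : Tendsto (fun t ↦ t * (1 / f t)) (𝓝[≠] 0) (𝓝 1) := by
    simpa [div_eq_mul_inv, mul_comm] using (tendsto_kricheverFun_div (α := α) hs).inv₀ one_ne_zero
  have hneg : Tendsto (fun t : ℂ ↦ -t) (𝓝[≠] 0) (𝓝[≠] 0) := by
    refine tendsto_nhdsWithin_of_tendsto_nhds_of_eventually_within _ ?_ ?_
    · simpa using (continuous_neg (G := ℂ)).continuousAt.tendsto.mono_left
        (nhdsWithin_le_nhds (a := (0 : ℂ)) (s := {0}ᶜ))
    · filter_upwards [self_mem_nhdsWithin] with z hz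
      simpa using hz
  have hE : Meromorphic fun t ↦ 1 / f t - 1 / f (-t) := fun t ↦ (hm t).fun_sub (hmneg t)
  refine false_of_odd_of_simple_pole L hE (fun w hw t ↦ ?_) (fun t ↦ by simp) (fun t ht ↦ ?_) ?_
  · have h1 : f (-(t + w)) = f (-t) := by
      rw [neg_add]
      exact hcon (-w) (neg_mem hw) (-t)
    simp only [h1, hcon w hw t]
  · refine (differentiableAt_one_div_kricheverFun hs ht).sub ?_
    have ht' : -t ∉ L.lattice := fun h ↦ ht (by simpa using neg_mem h)
    exact DifferentiableAt.comp (f := fun t : ℂ ↦ -t) t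
      (differentiableAt_one_div_kricheverFun (α := α) hs ht') (by fun_prop)
  · have hlimE : Tendsto (fun t ↦ t * (1 / f t - 1 / f (-t))) (𝓝[≠] 0) (𝓝 2) := by
      have h2 := hlim.add (hlim.comp hneg)
      rw [one_add_one_eq_two] at h2
      refine h2.congr fun t ↦ ?_
      simp only [Function.comp_apply]
      ring
    have hord := (tendsto_ne_zero_iff_meromorphicOrderAt_eq_zero
      ((MeromorphicAt.id (0 : ℂ)).fun_mul (hE 0))).mp ⟨2, two_ne_zero, hlimE⟩
    rw [fun_meromorphicOrderAt_mul (.id 0) (hE 0), meromorphicOrderAt_id] at hord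
    cases hx : meromorphicOrderAt (fun t ↦ 1 / f t - 1 / f (-t)) 0 with
    | top =>
      rw [hx, WithTop.add_top] at hord
      exact absurd hord WithTop.top_ne_zero
    | coe n =>
      rw [hx] at hord
      have : 1 + n = 0 := by exact_mod_cast hord
      rw [show n = -1 by omega]
      rfl

/-! ### Analytic continuation of the Hirzebruch equation -/

/-- The left-hand side of the Hirzebruch equation at `u = (x, v₀, …, vₙ₋₁)`, with the term of
`u₀ = x` separated from the others. -/
lemma sum_prod_erase_cons {n : ℕ} (F : ℂ → ℂ) (x : ℂ) (v : Fin n → ℂ) :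
    ∑ k, ∏ i ∈ Finset.univ.erase k,
      F ((Fin.cons x v : Fin (n + 1) → ℂ) i - (Fin.cons x v : Fin (n + 1) → ℂ) k) =
    ∏ i, F (v i - x) + ∑ k, F (x - v k) * ∏ i ∈ Finset.univ.erase k, F (v i - v k) := by
  rw [Fin.sum_univ_succ]
  congr 1
  · rw [Fin.univ_succ, Finset.erase_cons, Finset.prod_map]
    simp
  · refine Finset.sum_congr rfl fun k _ ↦ ?_
    have h0 : (0 : Fin (n + 1)) ∈ Finset.univ.erase k.succ := by simp [Fin.succ_ne_zero k |>.symm]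
    have : (Finset.univ.erase k.succ).erase 0 = (Finset.univ.erase k).map (Fin.succEmb n) := by
      ext i
      refine Fin.cases ?_ (fun j ↦ ?_) i <;> simp [Fin.succ_ne_zero]
    rw [← Finset.mul_prod_erase _ _ h0, this, Finset.prod_map]
    simp

/-- The Hirzebruch equation holds for `u₀ = x` anywhere off the translates `vᵢ + Λ`, as long as
the other variables stay close to `0`: in the single variable `x` both sides are holomorphic on
the complement of a countable closed set, which is connected. -/
lemma exists_hirzebruchEquation_continued {f : ℂ → ℂ} {n : ℕ} {C : ℂ}
    (hd : ∀ t, t ∉ L.lattice → DifferentiableAt ℂ (fun t ↦ 1 / f t) t)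
    (hf : HirzebruchEquation n f C) :
    ∃ ρ > 0, ∀ v : Fin n → ℂ, Function.Injective v → (∀ i, ‖v i‖ < ρ) →
      ∀ x, (∀ i, x - v i ∉ L.lattice) →
        ∏ i, 1 / f (v i - x) +
          ∑ k, 1 / f (x - v k) * ∏ i ∈ Finset.univ.erase k, 1 / f (v i - v k) = C := by
  obtain ⟨ρ, hρ, hball⟩ := Metric.eventually_nhds_iff_ball.mp hf
  refine ⟨ρ, hρ, fun v hv hvρ x hx ↦ ?_⟩
  set S : Set ℂ := ⋃ i, (fun x ↦ x - v i) ⁻¹' (L.lattice : Set ℂ) with hS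
  have hSc : S.Countable := Set.countable_iUnion fun i ↦
    (countable_lattice L).preimage_of_injOn (sub_left_injective.injOn)
  have hSo : IsOpen Sᶜ := (isClosed_iUnion_of_finite fun i ↦
    L.isClosed_lattice.preimage (continuous_sub_right (v i))).isOpen_compl
  have hmem {x : ℂ} : x ∈ Sᶜ ↔ ∀ i, x - v i ∉ L.lattice := by simp [hS]
  set G : ℂ → ℂ := fun x ↦ ∏ i, 1 / f (v i - x) +
    ∑ k, 1 / f (x - v k) * ∏ i ∈ Finset.univ.erase k, 1 / f (v i - v k) with hG
  have hGd : DifferentiableOn ℂ G Sᶜ := by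
    intro x hx
    refine (DifferentiableAt.add ?_ ?_).differentiableWithinAt
    · refine DifferentiableAt.fun_finsetProd fun i _ ↦ ?_
      refine DifferentiableAt.comp (g := fun t ↦ 1 / f t) (f := fun x ↦ v i - x) x (hd _ ?_)
        (by fun_prop)
      exact fun h ↦ hmem.mp hx i (by simpa using neg_mem h)
    · refine DifferentiableAt.fun_sum fun k _ ↦ DifferentiableAt.mul_const ?_ _
      exact DifferentiableAt.comp (g := fun t ↦ 1 / f t) (f := fun x ↦ x - v k) x
        (hd _ (hmem.mp hx k)) (by fun_prop)
  obtain ⟨z₀, hz₀, hz₀S⟩ := (hSc.dense_compl ℂ).inter_open_nonempty _ Metric.isOpen_ball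
    ⟨0, Metric.mem_ball_self hρ⟩
  have hev : G =ᶠ[𝓝 z₀] fun _ ↦ C := by
    filter_upwards [Metric.isOpen_ball.mem_nhds hz₀, hSo.mem_nhds hz₀S] with x hxb hxS
    simp only [hG]
    rw [← sum_prod_erase_cons (fun t ↦ 1 / f t)]
    refine hball _ ?_ ?_
    · rw [mem_ball_zero_iff, pi_norm_lt_iff hρ]
      refine Fin.cases ?_ fun i ↦ ?_
      · simpa using hxb
      · simpa using hvρ i
    · refine Fin.cons_injective_iff.mpr ⟨?_, hv⟩
      rintro ⟨i, rfl⟩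
      exact hmem.mp hxS i (by simp)
  exact (hGd.analyticOnNhd hSo).eqOn_of_preconnected_of_eventuallyEq analyticOnNhd_const
    (isPreconnected_compl_of_countable hSc) hz₀S hev (hmem.mpr hx)

/-- Comparison of the Hirzebruch equation at `u₀ = x` and `u₀ = x + w`: if the shift by the
period `w` multiplies `f` by `δ`, the term of `u₀` is multiplied by `δ ^ n` and every other term
by `δ⁻¹`. -/
lemma multiplier_sub_eq {f : ℂ → ℂ} {n : ℕ} {C w δ x : ℂ} (hw : w ∈ L.lattice) (hδ0 : δ ≠ 0)
    (hδ : ∀ t, f (t + w) = δ * f t) {v : Fin n → ℂ}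
    (h : ∀ x, (∀ i, x - v i ∉ L.lattice) → ∏ i, 1 / f (v i - x) +
      ∑ k, 1 / f (x - v k) * ∏ i ∈ Finset.univ.erase k, 1 / f (v i - v k) = C)
    (hx : ∀ i, x - v i ∉ L.lattice) (hx0 : ∀ i, f (v i - x) ≠ 0) :
    δ ^ n - δ⁻¹ = C * (1 - δ⁻¹) * ∏ i, f (v i - x) := by
  have h1 := h x hx
  have h2 := h (x + w) fun i hi ↦ hx i <| by
    rw [add_sub_right_comm] at hi
    exact (L.lattice.add_mem_iff_left hw).mp hi
  have e1 (i : Fin n) : 1 / f (v i - (x + w)) = δ * (1 / f (v i - x)) := by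
    have := hδ (v i - (x + w))
    rw [show v i - (x + w) + w = v i - x by ring] at this
    rw [this, one_div, one_div, mul_inv, mul_inv_cancel_left₀ hδ0]
  have e2 (k : Fin n) : 1 / f (x + w - v k) = δ⁻¹ * (1 / f (x - v k)) := by
    rw [add_sub_right_comm, hδ, one_div, one_div, mul_inv]
  simp only [e1, e2, Finset.prod_mul_distrib, Finset.prod_const, Finset.card_univ,
    Fintype.card_fin, mul_assoc, ← Finset.mul_sum] at h2
  have hQ : (∏ i, 1 / f (v i - x)) * ∏ i, f (v i - x) = 1 := by
    rw [← Finset.prod_mul_distrib]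
    exact Finset.prod_eq_one fun i _ ↦ one_div_mul_cancel (hx0 i)
  linear_combination (-(δ ^ n - δ⁻¹)) * hQ + (h2 - δ⁻¹ * h1) * ∏ i, f (v i - x)

/-- The multiplier of a solution of the Hirzebruch `n`-equation is an `(n + 1)`-st root of
unity, and `C = 0` as soon as some multiplier is different from `1`. -/
lemma multiplier_of_hirzebruchEquation (hs : s ∉ L.lattice) {n : ℕ} (hn : 1 ≤ n) {C w δ : ℂ}
    (hf : HirzebruchEquation n (kricheverFun L s α) C) (hw : w ∈ L.lattice) (hδ0 : δ ≠ 0)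
    (hδ : ∀ t, kricheverFun L s α (t + w) = δ * kricheverFun L s α t) :
    δ ^ (n + 1) = 1 ∧ C * (1 - δ⁻¹) = 0 := by
  obtain ⟨ρ, hρ, hcont⟩ := exists_hirzebruchEquation_continued
    (fun t ht ↦ differentiableAt_one_div_kricheverFun (α := α) hs ht) hf
  set f := kricheverFun L s α with hfdef
  obtain ⟨r, hr, hrs⟩ := Metric.eventually_nhds_iff_ball.mp
    ((eventually_sub_notMem_lattice hs).and
      (eventually_nhdsWithin_iff.mp (eventually_notMem_lattice L 0)))
  -- Distinct `vᵢ` so small that no difference `vᵢ - vⱼ` is a zero or a pole of `f` for `i ≠ j`.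
  set ε := min ρ (r / 2) with hε
  have hε0 : 0 < ε := lt_min hρ (by linarith)
  have hn0 : (0 : ℝ) < n := by exact_mod_cast hn
  set v : Fin n → ℂ := fun i ↦ (((i : ℕ) / n * ε : ℝ) : ℂ) with hv
  have hvinj : Function.Injective v := by
    intro i j hij
    have h1 : (i : ℝ) / n * ε = (j : ℝ) / n * ε := Complex.ofReal_injective hij
    have h2 := mul_right_cancel₀ hε0.ne' h1
    rw [div_left_inj' hn0.ne'] at h2
    exact Fin.ext (by exact_mod_cast h2)
  have hvε (i : Fin n) : ‖v i‖ < ε := by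
    have hi : (i : ℝ) < n := by exact_mod_cast i.2
    rw [hv, Complex.norm_real, Real.norm_of_nonneg (by positivity)]
    calc (i : ℝ) / n * ε < 1 * ε := by
          gcongr
          rwa [div_lt_one hn0]
      _ = ε := one_mul ε
  have hsmall {i j : Fin n} : v i - v j ∈ Metric.ball (0 : ℂ) r := by
    rw [mem_ball_zero_iff]
    calc ‖v i - v j‖ ≤ ‖v i‖ + ‖v j‖ := norm_sub_le _ _
      _ < ε + ε := add_lt_add (hvε i) (hvε j)
      _ ≤ r := by linarith [min_le_right ρ (r / 2)]
  set i₀ : Fin n := ⟨0, hn⟩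
  -- As `x → v₀` the factor `f (v₀ - x)` tends to `f 0 = 0`.
  have hlim : Tendsto (fun x ↦ ∏ i, f (v i - x)) (𝓝[≠] (v i₀)) (𝓝 0) := by
    have hc : ContinuousAt (fun x ↦ ∏ i, f (v i - x)) (v i₀) := by
      refine tendsto_finsetProd _ fun i _ ↦ ?_
      exact ContinuousAt.comp (g := f) (f := fun x ↦ v i - x)
        (differentiableAt_kricheverFun (hrs _ hsmall).1).continuousAt (by fun_prop)
    have h0 : ∏ i, f (v i - v i₀) = 0 :=
      Finset.prod_eq_zero (Finset.mem_univ i₀) (by rw [sub_self, hfdef, kricheverFun_zero])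
    have := hc.tendsto.mono_left (nhdsWithin_le_nhds (s := {v i₀}ᶜ))
    rwa [h0] at this
  have hgood : ∀ᶠ x in 𝓝[≠] (v i₀), ∀ i, v i - x ∈ Metric.ball (0 : ℂ) r ∧ v i - x ≠ 0 := by
    rw [eventually_all]
    intro i
    have hc : ContinuousAt (fun x ↦ v i - x) (v i₀) := by fun_prop
    have hb := hc.eventually (Metric.isOpen_ball.mem_nhds (hsmall (i := i) (j := i₀)))
    refine (hb.filter_mono nhdsWithin_le_nhds).and ?_
    by_cases hi : i = i₀
    · filter_upwards [self_mem_nhdsWithin] with x hx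
      rw [hi]
      exact sub_ne_zero.mpr (Ne.symm hx)
    · exact (hc.eventually_ne (sub_ne_zero.mpr (hvinj.ne hi))).filter_mono nhdsWithin_le_nhds
  have heq : ∀ᶠ x in 𝓝[≠] (v i₀), δ ^ n - δ⁻¹ = C * (1 - δ⁻¹) * ∏ i, f (v i - x) := by
    filter_upwards [hgood] with x hx
    have hxL (i : Fin n) : v i - x ∉ L.lattice := (hrs _ (hx i).1).2 (hx i).2
    refine multiplier_sub_eq hw hδ0 hδ (hcont v hvinj fun i ↦ (hvε i).trans_le (min_le_left _ _))
      (fun i hi ↦ hxL i (by simpa using neg_mem hi))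
      fun i ↦ kricheverFun_ne_zero hs (hxL i) (hrs _ (hx i).1).1
  have h0 : δ ^ n - δ⁻¹ = 0 := by
    have h1 := (hlim.const_mul (C * (1 - δ⁻¹))).congr' (heq.mono fun x hx ↦ hx.symm)
    rw [mul_zero] at h1
    exact tendsto_nhds_unique tendsto_const_nhds h1
  constructor
  · rw [pow_succ, sub_eq_zero.mp h0, inv_mul_cancel₀ hδ0]
  · obtain ⟨x, hx, hxg⟩ := (heq.and hgood).exists
    rw [h0] at hx
    refine (mul_eq_zero.mp hx.symm).resolve_right (Finset.prod_ne_zero_iff.mpr fun i _ ↦ ?_)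
    exact kricheverFun_ne_zero hs ((hrs _ (hxg i).1).2 (hxg i).2) (hrs _ (hxg i).1).1

end Krichever

theorem mainTheorem2 (L : PeriodPair) (s : ℂ) (hs : s ∉ L.lattice) (α : ℂ)
    (n : ℕ) (hn : 1 ≤ n) (C : ℂ)
    (hf : Krichever.HirzebruchEquation n (Krichever.kricheverFun L s α) C) :
    C = 0 ∧
    (∀ w ∈ L.lattice, ∃ ε : ℂ,
      Krichever.IsMultiplier L (Krichever.kricheverFun L s α) w ε ∧ ε ^ (n + 1) = 1) ∧
    ∃ d : ℕ, d ∣ n + 1 ∧ Krichever.IsEllipticOfLevel L d (Krichever.kricheverFun L s α) := by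
  refine ⟨?_, fun w hw ↦ ?_, n + 1, dvd_rfl, ?_⟩
  · obtain ⟨w, hw, t, ht⟩ := Krichever.exists_kricheverFun_add_ne (α := α) hs
    obtain ⟨δ, hδ0, hδ⟩ := Krichever.exists_kricheverFun_add s α hw
    have hδ1 : 1 - δ⁻¹ ≠ 0 := by
      intro h
      have : δ = 1 := by simpa using (sub_eq_zero.mp h).symm
      exact ht (by rw [hδ, this, one_mul])
    exact (mul_eq_zero.mp
      (Krichever.multiplier_of_hirzebruchEquation hs hn hf hw hδ0 hδ).2).resolve_right hδ1
  · obtain ⟨δ, hδ0, hδ⟩ := Krichever.exists_kricheverFun_add s α hw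
    refine ⟨δ⁻¹, fun t _ ↦ ?_, ?_⟩
    · rw [hδ, one_div, mul_inv, div_eq_mul_inv]
    · rw [inv_pow, (Krichever.multiplier_of_hirzebruchEquation hs hn hf hw hδ0 hδ).1, inv_one]
  · refine Krichever.isEllipticOfLevel_kricheverFun hs (by omega) fun w hw t ↦ ?_
    obtain ⟨δ, hδ0, hδ⟩ := Krichever.exists_kricheverFun_add s α hw
    rw [hδ, mul_pow, (Krichever.multiplier_of_hirzebruchEquation hs hn hf hw hδ0 hδ).1, one_mul]
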